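/- Let $X_1, X_2, \dots$ be i.i.d. real random variables with cumulative distribution function $F$, and let $G$ be a hypothesised cumulative distribution function that has a probability density. Let $(h_j)_{j \ge 0}$ be an orthonormal system in $L^2[0,1]$ with $h_0 = 1$ (for instance an orthonormal basis of $L^2[0,1]$ containing the constant $1$). For $n \ge 1$ and $j \ge 1$ put $$\hat\theta_j = \frac1n \sum_{i=1}^n h_j\bigl(G(X_i)\bigr),$$ and for a fixed integer $m \ge 1$ let the K-statistic be $K_m = \max_{1 \le j \le m} n\,\hat\theta_j^{\,2}$ (which depends on the sample size $n$). Let $\chi^2_1$ denote a random variable distributed as the square of a standard normal variable. Suppose the null hypothesis $H_0 : F = G$ holds. Then, as $n \to \infty$, $K_m$ converges in distribution to $\max_{1 \le j \le m} W_j$, where $W_1, \dots, W_m$ are i.i.d. with the $\chi^2_1$ distribution. Consequently the asymptotic p-value of an observed value $k_m$ of $K_m$ is $1 - P(\chi^2_1 \le k_m)^m$; that is, for every real $k$, $$\lim_{n \to \infty} P(K_m > k) = P\Bigl(\max_{1\le j\le m} W_j > k\Bigr) = 1 - P(\chi^2_1 \le k)^m .$$ -/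

import Mathlib

open MeasureTheory ProbabilityTheory Filter Topology

noncomputable section

/-- An orthonormal system `h 0, h 1, h 2, …` of real functions in `L²([0,1])` whose first member
is the constant function `1`. The values of `h j` outside `[0,1]` are irrelevant. Completeness of
the system is not required, so every orthonormal basis with `h 0 = 1` is covered. -/
structure IsOrthonormalSystem (h : ℕ → ℝ → ℝ) : Prop where
  memLp : ∀ j, MemLp (h j) 2 (volume.restrict (Set.Icc (0 : ℝ) 1))
  orthonormal : ∀ i j, ∫ u in Set.Icc (0 : ℝ) 1, h i u * h j u = if i = j then 1 else 0
  zero_eq_one : ∀ u ∈ Set.Icc (0 : ℝ) 1, h 0 u = 1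

/-- The empirical coefficient `θ̂_j = (1/n) ∑ h_j (G (x_i))` computed from the first `n`
observations; `cdf G` is the distribution function of the hypothesised law `G`. -/
def empiricalCoeff (G : Measure ℝ) (h : ℕ → ℝ → ℝ) (n : ℕ) (x : ℕ → ℝ) (j : ℕ) : ℝ :=
  (1 / (n : ℝ)) * ∑ i ∈ Finset.range n, h j (cdf G (x i))

/-- The maximum of `m ≥ 1` real numbers. -/
def maxOf {m : ℕ} [NeZero m] (a : Fin m → ℝ) : ℝ :=
  Finset.univ.sup' Finset.univ_nonempty a

/-- The K-statistic `K_m = max_{1 ≤ j ≤ m} n θ̂_j ^ 2` of the first `n` observations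
(the index `j : Fin m` starts at `0`, hence the shift). -/
def kStatistic (G : Measure ℝ) (h : ℕ → ℝ → ℝ) (m : ℕ) [NeZero m] (n : ℕ) (x : ℕ → ℝ) : ℝ :=
  maxOf fun j : Fin m => (n : ℝ) * empiricalCoeff G h n x ((j : ℕ) + 1) ^ 2

/-- The chi-squared distribution with one degree of freedom: the law of the square of a standard
normal random variable. -/
def chiSquaredOne : Measure ℝ :=
  (gaussianReal 0 1).map fun z => z ^ 2

end

/-!
Under the null hypothesis the observations have the law `G`, which has no atoms, so `G(X_i)` is
uniform on `[0,1]` (`map_cdf_eq_uniform`). Hence the vectors `(h_1(G(X_i)), …, h_m(G(X_i)))` are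
i.i.d.; they are centred because each `h_j` with `j ≥ 1` is orthogonal to `h_0 = 1`, and
orthonormality says exactly that their covariance is the identity.

The multivariate central limit theorem (`tendstoInDistribution_stdGaussian`) then gives convergence
of `n^{-1/2} ∑ (h_1(G(X_i)), …, h_m(G(X_i)))` to a standard Gaussian vector. It is deduced from the
one-dimensional theorem applied to the projections on each direction, together with Lévy's
convergence theorem. The K-statistic is the largest squared coordinate of this normalised sum
(`kStatistic_eq_maxSq`), so the continuous mapping theorem gives its limit law, which is the law of
the maximum of `m` independent `χ²₁` variables (`map_maxSq_stdGaussian`). That law has no atoms and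
its distribution function is the `m`-th power of the one of `χ²₁`, so the portmanteau theorem gives
the convergence of the tail probabilities.
-/

/-! ### The probability integral transform -/

/-- The distribution function of a law without atoms is continuous. -/
lemma continuous_cdf (G : Measure ℝ) [IsProbabilityMeasure G] [NullSingletonClass G] :
    Continuous (cdf G) := by
  refine continuous_iff_continuousAt.2 fun x => ?_
  rw [(monotone_cdf G).continuousAt_iff_leftLim_eq_rightLim, StieltjesFunction.rightLim_eq]
  have h0 := (cdf G).measure_singleton x
  rw [measure_cdf, measure_singleton, eq_comm, ENNReal.ofReal_eq_zero] at h0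
  exact le_antisymm ((monotone_cdf G).leftLim_le le_rfl) (by linarith)

/-- Every level strictly between `0` and `1` is attained by a continuous distribution function. -/
lemma exists_cdf_eq (G : Measure ℝ) [IsProbabilityMeasure G] [NullSingletonClass G] {a : ℝ}
    (h0 : 0 < a) (h1 : a < 1) : ∃ x, cdf G x = a := by
  obtain ⟨y, hy⟩ := ((tendsto_cdf_atBot G).eventually_lt_const h0).exists
  obtain ⟨z, hz⟩ := ((tendsto_cdf_atTop G).eventually_const_lt h1).exists
  exact mem_range_of_exists_le_of_exists_ge (continuous_cdf G) ⟨y, hy.le⟩ ⟨z, hz.le⟩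

/-- **Probability integral transform**: a law without atoms is transported to the uniform law on
`[0,1]` by its own distribution function. -/
lemma map_cdf_eq_uniform (G : Measure ℝ) [IsProbabilityMeasure G] [NullSingletonClass G] :
    G.map (cdf G) = volume.restrict (Set.Icc (0 : ℝ) 1) := by
  have hmeas : Measurable (cdf G) := (monotone_cdf G).measurable
  have : IsProbabilityMeasure (G.map (cdf G)) :=
    Measure.isProbabilityMeasure_map hmeas.aemeasurable
  refine Measure.ext_of_Iic _ _ fun a => ?_
  rw [Measure.map_apply hmeas measurableSet_Iic, Measure.restrict_apply measurableSet_Iic]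
  rcases lt_or_ge a 0 with ha0 | ha0
  · have e1 : cdf G ⁻¹' Set.Iic a = ∅ :=
      Set.eq_empty_of_forall_notMem fun x hx => (ha0.trans_le (cdf_nonneg G x)).not_ge hx
    have e2 : Set.Iic a ∩ Set.Icc (0 : ℝ) 1 = ∅ :=
      Set.eq_empty_of_forall_notMem fun x hx => (ha0.trans_le hx.2.1).not_ge hx.1
    simp [e1, e2]
  rcases le_or_gt 1 a with ha1 | ha1
  · have e1 : cdf G ⁻¹' Set.Iic a = Set.univ :=
      Set.eq_univ_of_forall fun x => (cdf_le_one G x).trans ha1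
    have e2 : Set.Iic a ∩ Set.Icc (0 : ℝ) 1 = Set.Icc 0 1 :=
      Set.inter_eq_right.2 fun x hx => hx.2.trans ha1
    simp [e1, e2]
  have e : Set.Iic a ∩ Set.Icc (0 : ℝ) 1 = Set.Icc 0 a := by
    ext x
    simp only [Set.mem_inter_iff, Set.mem_Iic, Set.mem_Icc]
    grind
  rw [e, Real.volume_Icc, sub_zero]
  apply le_antisymm
  · -- For `b > a` the event is contained in `Iic x`, where `cdf G x = b`; then `b` decreases to `a`.
    have key : ∀ b, a < b → b < 1 → G.real (cdf G ⁻¹' Set.Iic a) ≤ b := by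
      intro b hab hb1
      obtain ⟨x, hx⟩ := exists_cdf_eq G (ha0.trans_lt hab) hb1
      rw [← hx, cdf_eq_real]
      refine measureReal_mono fun y hy => ?_
      by_contra hxy
      have := monotone_cdf G (not_le.1 hxy).le
      have hy' : cdf G y ≤ a := hy
      linarith
    rw [← ofReal_measureReal]
    refine ENNReal.ofReal_le_ofReal (le_of_forall_gt_imp_ge_of_dense fun b hb => ?_)
    rcases lt_or_ge b 1 with hb1 | hb1
    · exact key b hb hb1
    · exact measureReal_le_one.trans hb1
  · rcases ha0.eq_or_lt with rfl | ha0
    · simp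
    obtain ⟨x, hx⟩ := exists_cdf_eq G ha0 ha1
    nth_rw 1 [← hx]
    rw [ofReal_cdf]
    exact measure_mono fun y hy => (monotone_cdf G hy).trans hx.le

/-! ### A central limit theorem in Euclidean space -/

/-- **Multivariate central limit theorem** for i.i.d. centred vectors with identity covariance,
both conditions being expressed through the one-dimensional projections `⟪V, t⟫`. -/
theorem tendstoInDistribution_stdGaussian {Ω Ω' E : Type*} [MeasurableSpace Ω]
    [MeasurableSpace Ω'] {P : Measure Ω} [IsProbabilityMeasure P] {P' : Measure Ω'}
    [IsProbabilityMeasure P'] [NormedAddCommGroup E] [InnerProductSpace ℝ E]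
    [FiniteDimensional ℝ E] [MeasurableSpace E] [BorelSpace E] {V : ℕ → Ω → E} {Z : Ω' → E}
    (hZ : HasLaw Z (stdGaussian E) P') (hL2 : MemLp (V 0) 2 P)
    (hmean : ∀ t, ∫ ω, inner ℝ (V 0 ω) t ∂P = 0)
    (hcov : ∀ t, ∫ ω, inner ℝ (V 0 ω) t ^ 2 ∂P = ‖t‖ ^ 2)
    (hindep : iIndepFun V P) (hident : ∀ i, IdentDistrib (V i) (V 0) P P) :
    TendstoInDistribution (fun (n : ℕ) ω => (√n)⁻¹ • ∑ k ∈ Finset.range n, V k ω) atTop Z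
      (fun _ => P) P' := by
  have hae (n : ℕ) : AEMeasurable (fun ω => (√n)⁻¹ • ∑ k ∈ Finset.range n, V k ω) P :=
    (Finset.aemeasurable_fun_sum _ fun i _ => (hident i).aemeasurable_fst).const_smul _
  refine ⟨hae, hZ.aemeasurable, ?_⟩
  -- By Lévy's theorem it suffices to treat the characteristic function at each `t`, which is the
  -- characteristic function at `1` of the normalised sum of the variables `⟪V k, t⟫`.
  refine ProbabilityMeasure.tendsto_iff_tendsto_charFun.2 fun t => ?_
  have hm : Measurable fun v : E => inner ℝ v t := by fun_prop
  have hproj : MemLp (fun ω => inner ℝ (V 0 ω) t) 2 P := by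
    exact hL2.inner_const t
  have hvar : Var[fun ω => inner ℝ (V 0 ω) t; P] = ‖t‖ ^ 2 := by
    rw [variance_of_integral_eq_zero hproj.aemeasurable (hmean t)]
    exact hcov t
  have hclt := tendstoInDistribution_inv_sqrt_mul_sum_sub
    (P := P) (X := fun k ω => inner ℝ (V k ω) t) (HasLaw.id (μ := gaussianReal 0 _)) hproj
    (hindep.comp (fun _ v => inner ℝ v t) fun _ => hm) (fun i => (hident i).comp hm)
  have h1 := ProbabilityMeasure.tendsto_iff_tendsto_charFun.1 hclt.tendsto 1
  simp only [ProbabilityMeasure.coe_mk] at h1 ⊢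
  rw [hZ.map_eq, charFun_stdGaussian]
  rw [Measure.map_id, charFun_gaussianReal, hvar, hmean] at h1
  convert! h1 using 2 with n
  · have hae' := hclt.forall_aemeasurable n
    rw [hmean] at hae'
    rw [charFun_apply, charFun_apply, integral_map (hae n) (by fun_prop),
      integral_map hae' (by fun_prop)]
    congr with ω
    simp [inner_smul_left, sum_inner]
  · simp [neg_div]

/-! ### The vector of orthonormal functions -/

/-- The vector `(h 1 u, …, h m u)` as a point of Euclidean space. -/
noncomputable def featureVector (h : ℕ → ℝ → ℝ) (m : ℕ) (u : ℝ) : EuclideanSpace ℝ (Fin m) :=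
  WithLp.toLp 2 fun j => h ((j : ℕ) + 1) u

lemma inner_featureVector (h : ℕ → ℝ → ℝ) (m : ℕ) (u : ℝ) (t : EuclideanSpace ℝ (Fin m)) :
    inner ℝ (featureVector h m u) t = ∑ j : Fin m, t j * h ((j : ℕ) + 1) u := by
  simp [featureVector, PiLp.inner_apply]

namespace IsOrthonormalSystem

variable {h : ℕ → ℝ → ℝ}

lemma integrable_mul (hh : IsOrthonormalSystem h) (i j : ℕ) :
    Integrable (fun u => h i u * h j u) (volume.restrict (Set.Icc (0 : ℝ) 1)) :=
  (hh.memLp i).integrable_mul (hh.memLp j)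

/-- Every member of the system other than the constant has mean zero, being orthogonal to it. -/
lemma integral_succ_eq_zero (hh : IsOrthonormalSystem h) (j : ℕ) :
    ∫ u in Set.Icc (0 : ℝ) 1, h (j + 1) u = 0 := by
  have h0 := hh.orthonormal 0 (j + 1)
  rw [if_neg (Nat.succ_ne_zero j).symm] at h0
  refine Eq.trans ?_ h0
  exact setIntegral_congr_fun measurableSet_Icc fun u hu => by simp [hh.zero_eq_one u hu]

lemma memLp_featureVector (hh : IsOrthonormalSystem h) (m : ℕ) :
    MemLp (featureVector h m) 2 (volume.restrict (Set.Icc (0 : ℝ) 1)) :=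
  MemLp.of_eval_piLp fun j => hh.memLp ((j : ℕ) + 1)

lemma integral_inner_featureVector (hh : IsOrthonormalSystem h) (m : ℕ)
    (t : EuclideanSpace ℝ (Fin m)) :
    ∫ u in Set.Icc (0 : ℝ) 1, inner ℝ (featureVector h m u) t = 0 := by
  simp_rw [inner_featureVector]
  rw [integral_finsetSum _ fun j _ => ((hh.memLp _).integrable (by norm_num)).const_mul _]
  simp [integral_const_mul, hh.integral_succ_eq_zero]

/-- Orthonormality says that the vector of functions has identity covariance. -/
lemma integral_inner_featureVector_sq (hh : IsOrthonormalSystem h) (m : ℕ)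
    (t : EuclideanSpace ℝ (Fin m)) :
    ∫ u in Set.Icc (0 : ℝ) 1, inner ℝ (featureVector h m u) t ^ 2 = ‖t‖ ^ 2 := by
  have e : ∀ u, inner ℝ (featureVector h m u) t ^ 2 = ∑ i : Fin m, ∑ j : Fin m,
      (t i * t j) * (h ((i : ℕ) + 1) u * h ((j : ℕ) + 1) u) := fun u => by
    rw [inner_featureVector, sq, Finset.sum_mul_sum]
    exact Finset.sum_congr rfl fun i _ => Finset.sum_congr rfl fun j _ => by ring
  simp_rw [e]
  rw [integral_finsetSum _ fun i _ => integrable_finsetSum _ fun j _ =>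
    (hh.integrable_mul _ _).const_mul _]
  simp_rw [fun i : Fin m => integral_finsetSum Finset.univ fun (j : Fin m) _ =>
    (hh.integrable_mul ((i : ℕ) + 1) ((j : ℕ) + 1)).const_mul (t i * t j), integral_const_mul,
    hh.orthonormal, Nat.add_right_cancel_iff, Fin.val_inj]
  rw [EuclideanSpace.real_norm_sq_eq]
  simp [sq]

end IsOrthonormalSystem

/-! ### The maximum of independent chi-squared variables -/

lemma measurable_maxOf {m : ℕ} [NeZero m] : Measurable (maxOf : (Fin m → ℝ) → ℝ) :=
  (Continuous.finset_sup'_apply Finset.univ_nonempty fun j _ => continuous_apply j).measurable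

/-- The largest squared coordinate of a vector. -/
noncomputable def maxSq {m : ℕ} [NeZero m] (v : EuclideanSpace ℝ (Fin m)) : ℝ :=
  maxOf fun j => v j ^ 2

lemma continuous_maxSq {m : ℕ} [NeZero m] :
    Continuous (maxSq : EuclideanSpace ℝ (Fin m) → ℝ) :=
  Continuous.finset_sup'_apply Finset.univ_nonempty fun j _ => by fun_prop

/-- The normalisation `n θ̂_j ^ 2 = (n^{-1/2} ∑ h_j) ^ 2` turns the K-statistic into a continuous
function of a normalised vector sum; it also holds for `n = 0`, where both sides vanish. -/
lemma kStatistic_eq_maxSq (G : Measure ℝ) (h : ℕ → ℝ → ℝ) (m : ℕ) [NeZero m] (n : ℕ)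
    (x : ℕ → ℝ) :
    kStatistic G h m n x =
      maxSq ((√n)⁻¹ • ∑ k ∈ Finset.range n, featureVector h m (cdf G (x k))) := by
  simp only [kStatistic, maxSq, empiricalCoeff]
  congr 1
  ext j
  simp only [PiLp.smul_apply, WithLp.ofLp_sum, Finset.sum_apply, featureVector, smul_eq_mul,
    mul_pow, inv_pow, Real.sq_sqrt (Nat.cast_nonneg n)]
  rcases eq_or_ne n 0 with rfl | hn
  · simp
  · field_simp

instance : IsProbabilityMeasure chiSquaredOne :=
  Measure.isProbabilityMeasure_map (by fun_prop)

instance : NullSingletonClass chiSquaredOne := by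
  refine ⟨fun x => ?_⟩
  rw [chiSquaredOne, Measure.map_apply (by fun_prop) (measurableSet_singleton x)]
  have : NullSingletonClass (gaussianReal 0 1) := nullSingletonClass_gaussianReal one_ne_zero
  refine Set.Finite.measure_zero (Set.Finite.subset (Set.toFinite {√x, -√x}) fun z hz => ?_) _
  have hz' : z ^ 2 = x := hz
  subst hz'
  rw [Real.sqrt_sq_eq_abs]
  grind

lemma map_maxSq_stdGaussian (m : ℕ) [NeZero m] :
    (stdGaussian (EuclideanSpace ℝ (Fin m))).map maxSq =
      (Measure.pi fun _ : Fin m => chiSquaredOne).map maxOf := by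
  rw [← map_pi_eq_stdGaussian, Measure.map_map continuous_maxSq.measurable (by fun_prop)]
  simp only [chiSquaredOne]
  rw [← Measure.pi_map_pi fun _ => by fun_prop,
    Measure.map_map measurable_maxOf (by fun_prop)]
  rfl

/-- The maximum is at most `k` exactly when every coordinate is, which gives the `m`-th power. -/
lemma measureReal_map_maxOf_Iic (m : ℕ) [NeZero m] (k : ℝ) :
    ((Measure.pi fun _ : Fin m => chiSquaredOne).map maxOf).real (Set.Iic k) =
      chiSquaredOne.real (Set.Iic k) ^ m := by
  rw [map_measureReal_apply measurable_maxOf measurableSet_Iic]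
  have : maxOf ⁻¹' Set.Iic k = Set.univ.pi fun _ : Fin m => Set.Iic k := by
    ext a
    simp [maxOf, -Set.pi_univ_Iic]
  simp [this, measureReal_def, Measure.pi_pi, -Set.pi_univ_Iic]

/-- The maximum equals `k` only if some coordinate does. -/
lemma map_maxOf_singleton (m : ℕ) [NeZero m] (k : ℝ) :
    (Measure.pi fun _ : Fin m => chiSquaredOne).map maxOf {k} = 0 := by
  rw [Measure.map_apply measurable_maxOf (measurableSet_singleton k)]
  refine measure_mono_null (t := ⋃ j : Fin m, Function.eval j ⁻¹' {k}) (fun a ha => ?_)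
    (measure_iUnion_null fun j => ?_)
  · obtain ⟨j, -, hj⟩ := Finset.exists_mem_eq_sup' (Finset.univ_nonempty (α := Fin m)) a
    exact Set.mem_iUnion.2 ⟨j, hj.symm.trans ha⟩
  · exact Measure.pi_hyperplane (fun _ : Fin m => chiSquaredOne) j k

/-! ### The limit law of the K-statistic -/

theorem mainTheorem2
    {Ω Ω' : Type*} [MeasurableSpace Ω] [MeasurableSpace Ω']
    (P : Measure Ω) [IsProbabilityMeasure P] (P' : Measure Ω') [IsProbabilityMeasure P']
    -- `F` is the true law of the data, `G` the hypothesised law, which has a density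
    (F G : Measure ℝ) [IsProbabilityMeasure F] [IsProbabilityMeasure G] (hG : G ≪ volume)
    -- the observations are i.i.d. with law `F`
    (X : ℕ → Ω → ℝ) (hX_law : ∀ i, HasLaw (X i) F P) (hX_indep : iIndepFun X P)
    (h : ℕ → ℝ → ℝ) (hh : IsOrthonormalSystem h)
    (m : ℕ) [NeZero m]
    -- `W` consists of `m` i.i.d. chi-squared variables with one degree of freedom
    (W : Fin m → Ω' → ℝ) (hW_law : ∀ j, HasLaw (W j) chiSquaredOne P')
    (hW_indep : iIndepFun W P')
    -- the null hypothesis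
    (H0 : cdf F = cdf G) :
    TendstoInDistribution (fun (n : ℕ) (ω : Ω) => kStatistic G h m n (fun i => X i ω)) atTop
        (fun ω' => maxOf fun j => W j ω') (fun _ => P) P' ∧
      ∀ k : ℝ,
        P'.real {ω' | k < maxOf fun j => W j ω'} = 1 - chiSquaredOne.real (Set.Iic k) ^ m ∧
        Tendsto (fun n : ℕ => P.real {ω | k < kStatistic G h m n (fun i => X i ω)}) atTop
          (𝓝 (1 - chiSquaredOne.real (Set.Iic k) ^ m)) := by
  have hFG : F = G := Measure.eq_of_cdf F G H0
  subst hFG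
  have : NullSingletonClass F := ⟨fun x => hG Real.volume_singleton⟩
  set lam : Measure ℝ := volume.restrict (Set.Icc (0 : ℝ) 1)
  have hU : HasLaw (cdf F) lam F :=
    ⟨(monotone_cdf F).measurable.aemeasurable, map_cdf_eq_uniform F⟩
  have hUX (i : ℕ) : HasLaw (fun ω => cdf F (X i ω)) lam P := hU.comp (hX_law i)
  have hV := hh.memLp_featureVector m
  -- `h j` is only almost everywhere measurable, hence the almost-everywhere composition lemmas.
  have hVU (i : ℕ) : HasLaw (fun ω => featureVector h m (cdf F (X i ω)))
      (lam.map (featureVector h m)) P :=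
    HasLaw.comp (Y := featureVector h m) ⟨hV.aemeasurable, rfl⟩ (hUX i)
  have hindep : iIndepFun (fun i ω => featureVector h m (cdf F (X i ω))) P := by
    refine (hX_indep.comp (fun _ => cdf F) fun _ => (monotone_cdf F).measurable).comp₀
      (fun _ => featureVector h m) (fun i => (hUX i).aemeasurable) fun i => ?_
    have e : P.map (cdf F ∘ X i) = lam := (hUX i).map_eq
    rw [e]
    exact hV.aemeasurable
  have hasLaw_max : HasLaw (fun ω' => maxOf fun j => W j ω')
      ((Measure.pi fun _ : Fin m => chiSquaredOne).map maxOf) P' :=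
    HasLaw.comp (Y := maxOf) ⟨measurable_maxOf.aemeasurable, rfl⟩ (hW_indep.hasLaw_pi hW_law)
  have hclt := (tendstoInDistribution_stdGaussian (P := P)
    (V := fun i ω => featureVector h m (cdf F (X i ω)))
    (HasLaw.id (μ := stdGaussian (EuclideanSpace ℝ (Fin m))))
    (by
      have hV' : MemLp (featureVector h m) 2 (P.map fun ω => cdf F (X 0 ω)) := by
        rwa [(hUX 0).map_eq]
      exact hV'.comp_of_map (hUX 0).aemeasurable)
    (fun t => ((hUX 0).integral_comp (hV.inner_const t).aestronglyMeasurable).trans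
      (hh.integral_inner_featureVector m t))
    (fun t => ((hUX 0).integral_comp ((hV.inner_const t).aestronglyMeasurable.pow 2)).trans
      (hh.integral_inner_featureVector_sq m t))
    hindep
    (fun i => ⟨(hVU i).aemeasurable, (hVU 0).aemeasurable,
      (hVU i).map_eq.trans (hVU 0).map_eq.symm⟩)).continuous_comp continuous_maxSq
  have hK (n : ℕ) : (fun ω => kStatistic F h m n fun i => X i ω) = maxSq ∘ fun ω =>
      (√n)⁻¹ • ∑ k ∈ Finset.range n, featureVector h m (cdf F (X k ω)) :=
    funext fun ω => kStatistic_eq_maxSq F h m n _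
  have hconv : TendstoInDistribution (fun (n : ℕ) (ω : Ω) => kStatistic F h m n fun i => X i ω)
      atTop (fun ω' => maxOf fun j => W j ω') (fun _ => P) P' := by
    refine ⟨fun n => hK n ▸ hclt.forall_aemeasurable n, hasLaw_max.aemeasurable, ?_⟩
    convert! hclt.tendsto using 2
    · simp only [hK]
    · refine congrArg 𝓝 (Subtype.ext ?_)
      exact hasLaw_max.map_eq.trans (map_maxSq_stdGaussian m).symm
  refine ⟨hconv, fun k => ?_⟩
  have hlim : P'.real {ω' | k < maxOf fun j => W j ω'} =
      1 - chiSquaredOne.real (Set.Iic k) ^ m := by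
    have : IsProbabilityMeasure ((Measure.pi fun _ : Fin m => chiSquaredOne).map maxOf) :=
      Measure.isProbabilityMeasure_map measurable_maxOf.aemeasurable
    rw [hasLaw_max.measureReal_eq (p := fun x => k < x) measurableSet_Ioi,
      ← measureReal_map_maxOf_Iic, ← probReal_compl_eq_one_sub measurableSet_Iic, Set.compl_Iic]
    rfl
  refine ⟨hlim, ?_⟩
  -- The limit law does not charge the boundary `{k}` of `(k, ∞)`.
  have hport := ProbabilityMeasure.tendsto_measure_of_null_frontier_of_tendsto' hconv.tendsto
    (E := Set.Ioi k) (by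
      simp only [ProbabilityMeasure.coe_mk]
      rw [frontier_Ioi, hasLaw_max.map_eq, map_maxOf_singleton])
  have : IsProbabilityMeasure (P'.map fun ω' => maxOf fun j => W j ω') :=
    Measure.isProbabilityMeasure_map hasLaw_max.aemeasurable
  have hreal := (ENNReal.tendsto_toReal
    (measure_ne_top (P'.map fun ω' => maxOf fun j => W j ω') (Set.Ioi k))).comp hport
  rw [← hlim]
  convert! hreal using 1
  · ext n
    simp only [Function.comp, ProbabilityMeasure.coe_mk]
    rw [Measure.map_apply_of_aemeasurable (hconv.forall_aemeasurable n) measurableSet_Ioi]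
    rfl
  · refine congrArg 𝓝 ?_
    rw [Measure.map_apply_of_aemeasurable hasLaw_max.aemeasurable measurableSet_Ioi]
    rfl
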